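/- Let $U=(1,1)$ and $D_k=(1,-k)$ for $k\ge 1$. A Dyck path with air pockets is a non-empty lattice path in the first quadrant of $\mathbb{Z}^2$ that starts at the origin, ends on the $x$-axis, and consists of steps $U$ and $D_k$ ($k\ge1$), no two down-steps being consecutive. Its length is its number of steps, and $\mathcal{A}_n$ denotes the (finite) set of Dyck paths with air pockets of length $n$. For $k\ge 1$, a $k$-pyramid in a path is an occurrence of the pattern $U^kD_k$ as a block of consecutive steps, and the popularity $\mathbf{\Delta}_k(\mathcal{A}_n)$ is the total number of $k$-pyramids in all the paths of $\mathcal{A}_n$. (i) For every $k\ge 1$, $$\sum_{n\ge 0}\mathbf{\Delta}_k(\mathcal{A}_n)\,x^n=\frac{x^{k+1}\left(1+2x^2-x^3+(1-x)\sqrt{(x^2+x+1)(x^2-3x+1)}\right)}{2\sqrt{(x^2+x+1)(x^2-3x+1)}}$$ as formal power series, where the square root is the one with constant term $1$. (ii) For all $k\ge 1$ and $n\ge 2$, $\mathbf{\Delta}_1(\mathcal{A}_n)=\mathbf{\Delta}_k(\mathcal{A}_{n+k-1})$. (iii) For every fixed $k\ge 1$, as $n\to\infty$, $$\mathbf{\Delta}_k(\mathcal{A}_n)\sim\frac{\sqrt5-1}{2\sqrt{\pi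 n}\,\sqrt{14\sqrt5-30}}\left(\frac{3+\sqrt5}{2}\right)^{n-k-1}.$$ -/

import Mathlib

namespace AirPockets

/-- The steps of the lattice paths: the up-step `U = (1, 1)` and the down-steps `D k = (1, -k)`.
The constraint `1 ≤ k` is part of `IsDyckPath`. -/
inductive Step : Type
  | U : Step
  | D (k : ℕ) : Step
  deriving DecidableEq

/-- The vertical component of a step. -/
def Step.rise : Step → ℤ
  | Step.U => 1
  | Step.D k => -(k : ℤ)

/-- Being a down-step. -/
def Step.IsDown (s : Step) : Prop := ∃ k : ℕ, s = Step.D k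

/-- The ordinate of the endpoint of a path that starts at the origin. -/
def height (p : List Step) : ℤ := (p.map Step.rise).sum

/-- Dyck paths with air pockets. -/
structure IsDyckPath (p : List Step) : Prop where
  nonempty : p ≠ []
  down_pos : ∀ k : ℕ, Step.D k ∈ p → 1 ≤ k
  height_nonneg : ∀ q : List Step, q <+: p → 0 ≤ height q
  height_eq_zero : height p = 0
  no_consecutive_downs : p.IsChain (fun s t => ¬ (s.IsDown ∧ t.IsDown))

/-- The set `𝒜_n` of Dyck paths with air pockets of length (number of steps) `n`. -/
def paths (n : ℕ) : Set (List Step) := {p | p.length = n ∧ IsDyckPath p}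

theorem height_le_length (p : List Step) : height p ≤ p.length := by
  induction p with
  | nil => simp [height]
  | cons s p ih =>
    have hs : s.rise ≤ 1 := by cases s <;> simp [Step.rise]
    simp only [height, List.map_cons, List.sum_cons, List.length_cons] at ih ⊢
    push_cast
    linarith

theorem down_le_length {p : List Step} (hp : IsDyckPath p) {k : ℕ} (hk : Step.D k ∈ p) :
    k ≤ p.length := by
  obtain ⟨s, t, rfl⟩ := List.append_of_mem hk
  have h := hp.height_nonneg (s ++ [Step.D k]) ⟨t, by simp⟩
  have hs := height_le_length s
  simp only [height, List.map_append, List.sum_append, List.map_cons, List.map_nil,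
    List.sum_cons, List.sum_nil, Step.rise] at h hs
  simp only [List.length_append, List.length_cons]
  omega

theorem paths_finite (n : ℕ) : (paths n).Finite := by
  let f : Option (Fin (n + 1)) → Step := fun o => o.elim Step.U (fun i => Step.D i)
  refine ((List.finite_length_eq (Option (Fin (n + 1))) n).image (List.map f)).subset ?_
  rintro p ⟨hl, hp⟩
  have hmem : ∀ s ∈ p, s ∈ Set.range f := by
    intro s hs
    cases s with
    | U => exact ⟨none, rfl⟩
    | D k => exact ⟨some ⟨k, by have := down_le_length hp hs; omega⟩, rfl⟩
  obtain ⟨l, rfl⟩ : p ∈ Set.range (List.map f) := by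
    rw [Set.range_list_map]
    exact hmem
  exact ⟨l, by simpa using hl, rfl⟩

/-- The number of occurrences of the pattern `w` as a block of consecutive steps of `p`
(the number of starting positions, that is, of suffixes of `p` that begin with `w`). -/
def occurrences (w p : List Step) : ℕ := p.tails.countP (fun t => w <+: t)

/-- The pattern `U^k D_k`. -/
def pyramid (k : ℕ) : List Step := List.replicate k Step.U ++ [Step.D k]

/-- The popularity of the pattern `w` in `𝒜_n`: its total number of occurrences. -/
noncomputable def popularity (w : List Step) (n : ℕ) : ℕ :=
  ∑ p ∈ (paths_finite n).toFinset, occurrences w p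

/-- The generating function of the popularity of `k`-pyramids. -/
noncomputable def pyramidGF (k : ℕ) : PowerSeries ℝ :=
  PowerSeries.mk (fun n => (popularity (pyramid k) n : ℝ))

end AirPockets

open AirPockets PowerSeries Filter Asymptotics

namespace AirPockets

/-! ### Closed paths and their last-passage decomposition -/

/-! Deleting a k-pyramid from a path and remembering where it stood leaves a possibly empty path,
shorter by k + 1 steps, with a marked position not followed by a down-step. Conversely, a k-pyramid
may be inserted at any such position (`isClosedPath_insert_pyramid`). A path has 1 + #U of these
positions, so the popularity at length m + k + 1 is the sum of 1 + #U over paths of length m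
(`popularity_pyramid_add`). This does not depend on k, which gives (ii), and the generating function
is x^(k+1) G with G = `closedGF upsWeight`.

Cutting a nonempty path at its last return to the axis before its end writes it uniquely as a U b',
where b' is a path b with its last descent lengthened by one (`join`). This gives a quadratic
equation for the series F of paths. Since 1 + #U is additive under `join`, it also gives an equation
linear in G, whose leading coefficient 1 + x - x² - 2xF is the required square root S. Hence (i).

For (iii), let ρ be the smaller root of x² - 3x + 1. Then G is (1 - x/ρ)^(-1/2) times a series
converging beyond ρ, plus a polynomial of degree 1. Dominated convergence
(`tendsto_coeff_rescale_invSqrtSeries_mul`) reduces its coefficients to those of (1 - x)^(-1/2),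
which Wallis' product estimates. -/

@[simp] theorem not_isDown_U : ¬ Step.U.IsDown := by rintro ⟨k, hk⟩; cases hk

@[simp] theorem isDown_D (k : ℕ) : (Step.D k).IsDown := ⟨k, rfl⟩

@[simp] theorem rise_U : Step.U.rise = 1 := rfl

@[simp] theorem rise_D (k : ℕ) : (Step.D k).rise = -(k : ℤ) := rfl

@[simp] theorem height_nil : height [] = 0 := rfl

@[simp] theorem height_cons (s : Step) (p : List Step) : height (s :: p) = s.rise + height p := by
  simp [height]

@[simp] theorem height_append (p q : List Step) : height (p ++ q) = height p + height q := by
  simp [height]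

/-- A path started at ordinate `h` stays weakly above the `x`-axis. -/
def NonnegFrom (h : ℤ) (p : List Step) : Prop := ∀ q : List Step, q <+: p → 0 ≤ h + height q

@[simp] theorem nonnegFrom_nil (h : ℤ) : NonnegFrom h [] ↔ 0 ≤ h := by
  simp [NonnegFrom]

@[simp] theorem nonnegFrom_cons (h : ℤ) (s : Step) (p : List Step) :
    NonnegFrom h (s :: p) ↔ 0 ≤ h ∧ NonnegFrom (h + s.rise) p := by
  constructor
  · intro H
    refine ⟨by simpa using H [] (by simp), fun q hq => ?_⟩
    have := H (s :: q) (by simpa using hq)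
    rw [height_cons] at this
    linarith
  · rintro ⟨h0, H⟩ q hq
    rcases List.prefix_cons_iff.1 hq with rfl | ⟨t, rfl, ht⟩
    · simpa using h0
    · have := H t ht
      rw [height_cons]
      linarith

theorem NonnegFrom.start {h : ℤ} {p : List Step} (H : NonnegFrom h p) : 0 ≤ h := by
  simpa using H [] (by simp)

theorem NonnegFrom.finish {h : ℤ} {p : List Step} (H : NonnegFrom h p) : 0 ≤ h + height p :=
  H p (List.prefix_refl p)

theorem nonnegFrom_append (h : ℤ) (p q : List Step) :
    NonnegFrom h (p ++ q) ↔ NonnegFrom h p ∧ NonnegFrom (h + height p) q := by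
  induction p generalizing h with
  | nil =>
    simp only [List.nil_append, nonnegFrom_nil, height_nil, add_zero]
    exact ⟨fun H => ⟨H.start, H⟩, fun H => H.2⟩
  | cons s p ih =>
    simp only [List.cons_append, nonnegFrom_cons, ih, height_cons, ← add_assoc, and_assoc]

/-- No two down-steps are consecutive. -/
abbrev NoConsecutiveDowns (p : List Step) : Prop :=
  p.IsChain (fun s t => ¬ (s.IsDown ∧ t.IsDown))

/-- Dyck paths with air pockets, the empty path included. -/
structure IsClosedPath (p : List Step) : Prop where
  down_pos : ∀ k : ℕ, Step.D k ∈ p → 1 ≤ k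
  nonneg : NonnegFrom 0 p
  height_eq_zero : height p = 0
  noConsecutiveDowns : NoConsecutiveDowns p

theorem isDyckPath_iff {p : List Step} : IsDyckPath p ↔ p ≠ [] ∧ IsClosedPath p := by
  constructor
  · rintro ⟨h1, h2, h3, h4, h5⟩
    exact ⟨h1, h2, by simpa [NonnegFrom] using h3, h4, h5⟩
  · rintro ⟨h1, h2, h3, h4, h5⟩
    exact ⟨h1, h2, by simpa [NonnegFrom] using h3, h4, h5⟩

theorem isClosedPath_nil : IsClosedPath [] := ⟨by simp, by simp, rfl, by simp⟩

/-- The closed paths of length `n`. -/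
noncomputable def closedPaths (n : ℕ) : Finset (List Step) :=
  if n = 0 then {[]} else (paths_finite n).toFinset

theorem mem_closedPaths {n : ℕ} {p : List Step} :
    p ∈ closedPaths n ↔ p.length = n ∧ IsClosedPath p := by
  unfold closedPaths
  split_ifs with hn
  · subst hn
    rw [Finset.mem_singleton, List.length_eq_zero_iff]
    exact ⟨fun h => ⟨h, h ▸ isClosedPath_nil⟩, fun h => h.1⟩
  · simp only [Set.Finite.mem_toFinset, paths, Set.mem_ofPred_eq, isDyckPath_iff]
    refine and_congr_right fun hl => and_iff_right ?_
    rintro rfl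
    exact hn (by simpa using hl.symm)

theorem IsClosedPath.eq_nil_or_concat {p : List Step} (hp : IsClosedPath p) :
    p = [] ∨ ∃ q k, p = q ++ [Step.D k] := by
  rcases List.eq_nil_or_concat p with rfl | ⟨q, s, rfl⟩
  · exact Or.inl rfl
  · refine Or.inr ⟨q, ?_⟩
    cases s with
    | D k => exact ⟨k, by simp⟩
    | U =>
      have h1 := hp.height_eq_zero
      have h2 := hp.nonneg q (by simp)
      simp at h1
      omega

/-- Lower the endpoint of a path by one, making its last down-step longer, or adding one to the
empty path. -/
def lower (p : List Step) : List Step :=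
  p.dropLast ++ [match p.getLast? with
    | some (Step.D k) => Step.D (k + 1)
    | _ => Step.D 1]

@[simp] theorem lower_nil : lower [] = [Step.D 1] := rfl

@[simp] theorem lower_concat (q : List Step) (k : ℕ) :
    lower (q ++ [Step.D k]) = q ++ [Step.D (k + 1)] := by
  simp [lower]

/-- The closed path built from two closed paths by last passage at the `x`-axis. -/
def join (p q : List Step) : List Step := p ++ Step.U :: lower q

theorem IsClosedPath.join {p q : List Step} (hp : IsClosedPath p) (hq : IsClosedPath q) :
    IsClosedPath (join p q) := by
  obtain ⟨p1, p2, p3, p4⟩ := hp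
  rcases hq.eq_nil_or_concat with rfl | ⟨q, k, rfl⟩
  · refine ⟨?_, ?_, ?_, ?_⟩
    · intro k hk
      simp only [AirPockets.join, lower_nil, List.mem_append, List.mem_cons, reduceCtorEq,
        Step.D.injEq, List.not_mem_nil, or_false, false_or] at hk
      rcases hk with hk | hk
      · exact p1 k hk
      · omega
    · simp [AirPockets.join, nonnegFrom_append, p2, p3]
    · simp [AirPockets.join, p3]
    · simp only [NoConsecutiveDowns, AirPockets.join, List.isChain_append, p4]
      simp
  · obtain ⟨q1, q2, q3, q4⟩ := hq
    simp only [nonnegFrom_append, height_append, height_cons, height_nil, rise_D] at q2 q3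
    have q2' : NonnegFrom 1 q := fun a ha => by have := q2.1 a ha; omega
    refine ⟨?_, ?_, ?_, ?_⟩
    · intro j hj
      simp only [AirPockets.join, lower_concat, List.mem_append, List.mem_cons, reduceCtorEq,
        Step.D.injEq, List.not_mem_nil, or_false, false_or] at hj
      rcases hj with hj | hj | hj
      · exact p1 j hj
      · exact q1 j (by simp [hj])
      · omega
    · simp [AirPockets.join, nonnegFrom_append, p2, p3, q2']
      omega
    · simp [AirPockets.join, p3]
      omega
    · simp only [NoConsecutiveDowns, List.isChain_append] at q4
      simp only [AirPockets.join, lower_concat, NoConsecutiveDowns, List.isChain_append,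
        List.isChain_cons, p4, q4]
      have := q4.2.2
      simp at this ⊢
      exact this

theorem height_nonneg_of_append_eq_lower {q a b : List Step} (hq : IsClosedPath q)
    (h : a ++ b = lower q) (hb : b ≠ []) : 0 ≤ height a := by
  have ha : a <+: q.dropLast := by
    obtain ⟨b, s, rfl⟩ := (List.eq_nil_or_concat b).resolve_left hb
    rw [lower, List.concat_eq_append, ← List.append_assoc] at h
    exact ⟨b, (List.append_inj' h rfl).1⟩
  simpa using hq.nonneg a (ha.trans q.dropLast_prefix)

theorem lower_injOn {p q : List Step} (hp : IsClosedPath p) (hq : IsClosedPath q)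
    (h : lower p = lower q) : p = q := by
  -- A final `D 1` can only come from the empty path: lengthening an existing down-step gives at
  -- least `D 2`.
  have key : ∀ (q : List Step) (k : ℕ), IsClosedPath (q ++ [Step.D k]) →
      [Step.D 1] ≠ q ++ [Step.D (k + 1)] := by
    intro q k hq h
    have h1 := hq.down_pos k (by simp)
    have h2 : Step.D 1 = Step.D (k + 1) :=
      List.head_eq_of_cons_eq (List.append_inj' (s₁ := []) h rfl).2
    simp at h2
    omega
  rcases hp.eq_nil_or_concat with rfl | ⟨p, k, rfl⟩ <;>
    rcases hq.eq_nil_or_concat with rfl | ⟨q, j, rfl⟩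
  · rfl
  · exact absurd (by simpa using h) (key q j hq)
  · exact absurd (by simpa using h.symm) (key p k hp)
  · simpa using h

/-- If the first factors differed, the longer would exceed the shorter by a block starting with `U`
and continuing along a proper prefix of some `lower q`. That block has height at least 1, yet both
factors end on the axis. -/
theorem join_injOn {p q p' q' : List Step} (hp : IsClosedPath p) (hq : IsClosedPath q)
    (hp' : IsClosedPath p') (hq' : IsClosedPath q') (h : join p q = join p' q') :
    p = p' ∧ q = q' := by
  have key : ∀ {p q a q' : List Step}, IsClosedPath p → IsClosedPath q →
      IsClosedPath (p ++ a) → Step.U :: lower q = a ++ Step.U :: lower q' → a = [] := by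
    intro p q a q' hp hq hpa h
    cases a with
    | nil => rfl
    | cons s a =>
      simp only [List.cons_append, List.cons.injEq] at h
      have h1 := height_nonneg_of_append_eq_lower hq h.2.symm (by simp)
      have h2 := hpa.height_eq_zero
      rw [← h.1] at h2
      simp [hp.height_eq_zero] at h2
      omega
  have hpp : p = p' := by
    rcases List.append_eq_append_iff.1 h with ⟨a, rfl, e⟩ | ⟨a, rfl, e⟩
    · simp [key hp hq hp' e]
    · simp [key hp' hq' hp e]
  subst hpp
  refine ⟨rfl, lower_injOn hq hq' ?_⟩
  simpa [join] using h

/-- Induction on the last step: the cut point moves to the end of the old path exactly when that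
path ends on the axis. -/
theorem exists_last_passage {p : List Step} (hne : p ≠ []) (hp : NonnegFrom 0 p) :
    ∃ a t, p = a ++ t ∧ t ≠ [] ∧ height a = 0 ∧
      ∀ q, q <+: t → q ≠ [] → q ≠ t → 1 ≤ height q := by
  induction p using List.reverseRecOn with
  | nil => exact absurd rfl hne
  | append_singleton p s ih =>
    have single : ∀ q : List Step, q <+: [s] → q ≠ [] → q ≠ [s] → 1 ≤ height q := by
      intro q hq h1 h2
      rcases List.prefix_cons_iff.1 hq with rfl | ⟨t, rfl, ht⟩
      · exact absurd rfl h1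
      · simp at ht
        simp [ht] at h2
    rcases eq_or_ne p [] with rfl | hpne
    · exact ⟨[], [s], rfl, by simp, rfl, single⟩
    have hp' := ((nonnegFrom_append _ _ _).1 hp).1
    obtain ⟨a, t, rfl, ht, ha, H⟩ := ih hpne hp'
    have hfin := hp'.finish
    rw [height_append, ha] at hfin
    rcases (show height t = 0 ∨ 1 ≤ height t by omega) with h0 | h1
    · exact ⟨a ++ t, [s], rfl, by simp, by simp [ha, h0], single⟩
    · refine ⟨a, t ++ [s], by simp, by simp, ha, fun q hq hq0 hqt => ?_⟩
      rcases List.prefix_concat_iff.1 hq with rfl | hq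
      · exact absurd rfl hqt
      · rcases eq_or_ne q t with rfl | hne
        · exact h1
        · exact H q hq hq0 hne

theorem IsClosedPath.exists_join {p : List Step} (hp : IsClosedPath p) (hne : p ≠ []) :
    ∃ a b, IsClosedPath a ∧ IsClosedPath b ∧ AirPockets.join a b = p := by
  obtain ⟨p1, p2, p3, p4⟩ := hp
  obtain ⟨a, t, rfl, ht, ha, H⟩ := exists_last_passage hne p2
  rw [nonnegFrom_append] at p2
  have hA : IsClosedPath a :=
    ⟨fun k hk => p1 k (by simp [hk]), p2.1, ha, p4.left_of_append⟩
  have hchain := p4.right_of_append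
  obtain ⟨s, t, rfl⟩ := List.exists_cons_of_ne_nil ht
  obtain rfl : s = Step.U := by
    cases s with
    | U => rfl
    | D k =>
      have h1 := p1 k (by simp)
      have h2 := p2.2 [Step.D k] (by simp)
      simp [ha] at h2
      omega
  simp only [height_append, ha, height_cons, rise_U] at p3
  rcases List.eq_nil_or_concat t with rfl | ⟨q, s, rfl⟩
  · simp at p3
  rw [List.concat_eq_append] at *
  have hq : NonnegFrom 0 q := by
    intro c hc
    have := H (Step.U :: c) (by simpa using hc.trans (q.prefix_append [s])) (by simp) (by
      intro h
      simp only [List.cons.injEq, true_and] at h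
      have := hc.length_le
      simp [h] at this)
    simp at this
    omega
  have hfin := hq.finish
  simp only [height_append, height_cons, height_nil] at p3
  cases s with
  | U => simp at p3; omega
  | D k =>
  simp only [rise_D] at p3
  -- If nothing lies between the first `U` and the final descent, the second factor is empty.
  -- Otherwise the step before the descent must be `U`, so the descent is at least 2 and can be
  -- shortened by one.
  rcases List.eq_nil_or_concat q with rfl | ⟨r, s, rfl⟩
  · refine ⟨a, [], hA, isClosedPath_nil, ?_⟩
    obtain rfl : k = 1 := by simp at p3; omega
    simp [AirPockets.join]
  · rw [List.concat_eq_append] at *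
    obtain rfl : s = Step.U := by
      cases s with
      | U => rfl
      | D j => simp [List.isChain_append, List.isChain_cons] at hchain
    have hr := ((nonnegFrom_append _ _ _).1 hq).1.finish
    obtain ⟨k, rfl⟩ : ∃ j, k = j + 2 := ⟨k - 2, by simp at p3; omega⟩
    refine ⟨a, r ++ [Step.U] ++ [Step.D (k + 1)], hA, ⟨?_, ?_, ?_, ?_⟩, ?_⟩
    · intro j hj
      simp only [List.mem_append, List.mem_cons, reduceCtorEq, Step.D.injEq, List.not_mem_nil,
        or_false] at hj
      rcases hj with hj | rfl
      · exact p1 j (by simp [hj])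
      · omega
    · rw [nonnegFrom_append]
      refine ⟨hq, ?_⟩
      simp at p3 ⊢
      omega
    · simp at p3 ⊢
      omega
    · have := hchain.tail.left_of_append
      simp only [NoConsecutiveDowns]
      rw [List.isChain_append]
      exact ⟨this, by simp, by simp⟩
    · rw [AirPockets.join, lower_concat]

/-! ### Generating functions of closed paths -/

theorem IsClosedPath.length_lower {q : List Step} (hq : IsClosedPath q) (hne : q ≠ []) :
    (lower q).length = q.length := by
  obtain ⟨q, k, rfl⟩ := hq.eq_nil_or_concat.resolve_left hne
  simp

theorem IsClosedPath.count_lower {q : List Step} (hq : IsClosedPath q) :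
    (lower q).count Step.U = q.count Step.U := by
  rcases hq.eq_nil_or_concat with rfl | ⟨q, k, rfl⟩ <;> simp [List.count_append]

theorem count_join {p q : List Step} (hq : IsClosedPath q) :
    (join p q).count Step.U = p.count Step.U + (q.count Step.U + 1) := by
  simp [join, hq.count_lower, List.count_append]

theorem closedPaths_zero : closedPaths 0 = {[]} := by simp [closedPaths]

theorem two_le_length_join (p q : List Step) : 2 ≤ (join p q).length := by
  simp [join, lower]
  omega

theorem closedPaths_one : closedPaths 1 = ∅ := by
  refine Finset.eq_empty_of_forall_notMem fun p hp => ?_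
  obtain ⟨hl, hp⟩ := mem_closedPaths.1 hp
  obtain ⟨a, b, -, -, rfl⟩ := hp.exists_join (by rintro rfl; simp at hl)
  have := two_le_length_join a b
  omega

/-- `lower` preserves the length of a nonempty path but turns the empty one into a single step, so
an empty second factor is counted separately and the other second factors have length `ij.2 + 1`. -/
theorem sum_closedPaths_add_two {M : Type*} [AddCommMonoid M] (f : List Step → M) (n : ℕ) :
    ∑ p ∈ closedPaths (n + 2), f p = ∑ a ∈ closedPaths n, f (join a []) +
      ∑ ij ∈ Finset.HasAntidiagonal.antidiagonal n,
        ∑ a ∈ closedPaths ij.1, ∑ b ∈ closedPaths (ij.2 + 1), f (join a b) := by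
  classical
  set P : Finset (List Step × List Step) :=
    (closedPaths n ×ˢ {[]}) ∪ (Finset.HasAntidiagonal.antidiagonal n).biUnion
      (fun ij => closedPaths ij.1 ×ˢ closedPaths (ij.2 + 1)) with hP
  have memP : ∀ x : List Step × List Step, x ∈ P ↔
      IsClosedPath x.1 ∧ IsClosedPath x.2 ∧ (join x.1 x.2).length = n + 2 := by
    rintro ⟨a, b⟩
    simp only [hP, Finset.mem_union, Finset.mem_product, Finset.mem_singleton, Finset.mem_biUnion,
      Finset.HasAntidiagonal.mem_antidiagonal, mem_closedPaths, Prod.exists]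
    constructor
    · rintro (⟨⟨hl, ha⟩, rfl⟩ | ⟨i, j, hij, ⟨hi, ha⟩, hj, hb⟩)
      · exact ⟨ha, isClosedPath_nil, by simp [join, hl]⟩
      · refine ⟨ha, hb, ?_⟩
        have := hb.length_lower (by rintro rfl; simp at hj)
        simp [join, this]
        omega
    · rintro ⟨ha, hb, h⟩
      rcases eq_or_ne b [] with rfl | hne
      · exact Or.inl ⟨⟨by simpa [join] using h, ha⟩, rfl⟩
      · have := hb.length_lower hne
        have := List.length_pos_of_ne_nil hne
        simp [join] at h
        exact Or.inr ⟨a.length, b.length - 1, by omega, ⟨rfl, ha⟩, by omega, hb⟩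
  have hsum : ∑ x ∈ P, f (join x.1 x.2) = ∑ p ∈ closedPaths (n + 2), f p := by
    refine Finset.sum_nbij (fun x => join x.1 x.2) ?_ ?_ ?_ (fun _ _ => rfl)
    · intro x hx
      obtain ⟨h1, h2, h3⟩ := (memP x).1 hx
      exact mem_closedPaths.2 ⟨h3, h1.join h2⟩
    · intro x hx y hy hxy
      obtain ⟨h1, h2, -⟩ := (memP x).1 hx
      obtain ⟨h3, h4, -⟩ := (memP y).1 hy
      exact Prod.ext_iff.2 (join_injOn h1 h2 h3 h4 hxy)
    · intro p hp
      obtain ⟨hl, hp⟩ := mem_closedPaths.1 hp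
      obtain ⟨a, b, ha, hb, rfl⟩ := hp.exists_join (by rintro rfl; simp at hl)
      exact ⟨(a, b), (memP (a, b)).2 ⟨ha, hb, hl⟩, rfl⟩
  rw [← hsum, hP, Finset.sum_union, Finset.sum_biUnion, Finset.sum_product]
  · simp only [Finset.sum_singleton, Finset.sum_product]
  · rintro ⟨i, j⟩ - ⟨i', j'⟩ - hne
    refine Finset.disjoint_left.2 ?_
    rintro ⟨a, b⟩ h h'
    simp only [Finset.mem_product, mem_closedPaths] at h h'
    exact hne (Prod.ext (by simp; omega) (by simp; omega))
  · refine Finset.disjoint_left.2 ?_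
    rintro ⟨a, b⟩ h h'
    simp only [Finset.mem_product, Finset.mem_singleton, Finset.mem_biUnion, mem_closedPaths] at h h'
    obtain ⟨ij, -, -, h', -⟩ := h'
    simp [h.2] at h'

/-- The generating function of closed paths, by length, with weight `f`. -/
noncomputable def closedGF (f : List Step → ℝ) : PowerSeries ℝ :=
  PowerSeries.mk fun n => ∑ p ∈ closedPaths n, f p

/-- The generating function of closed paths, without the constant term, divided by `X`. -/
noncomputable def closedGFTail (f : List Step → ℝ) : PowerSeries ℝ :=
  PowerSeries.mk fun n => ∑ p ∈ closedPaths (n + 1), f p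

theorem closedGF_eq_tail (f : List Step → ℝ) :
    closedGF f = C (f []) + X * closedGFTail f := by
  ext n
  cases n with
  | zero => simp [closedGF, closedPaths_zero]
  | succ n => simp [closedGF, closedGFTail, coeff_succ_X_mul]

theorem closedGF_eq_of_coeff {f : List Step → ℝ} {G : PowerSeries ℝ}
    (h : ∀ n, ∑ p ∈ closedPaths (n + 2), f p = coeff n G) :
    closedGF f = C (f []) + X ^ 2 * G := by
  ext n
  match n with
  | 0 => simp [closedGF, closedPaths_zero]
  | 1 => simp [closedGF, closedPaths_one, coeff_X_pow_mul']
  | n + 2 => simp [closedGF, h, coeff_X_pow_mul]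

theorem closedGF_one_eq :
    closedGF 1 = 1 + X ^ 2 * (closedGF 1 + closedGF 1 * closedGFTail 1) := by
  have := closedGF_eq_of_coeff (f := 1) (G := closedGF 1 + closedGF 1 * closedGFTail 1) ?_
  · simpa using this
  · intro n
    rw [sum_closedPaths_add_two, map_add, coeff_mul]
    simp [closedGF, closedGFTail]

/-- The weight `1 + #U`. -/
def upsWeight (p : List Step) : ℝ := 1 + p.count Step.U

/-- The extra `U` created by `join` makes the weight exactly additive, so the product rule applies
to the equation for `closedGF 1`. -/
theorem closedGF_upsWeight_eq :
    closedGF upsWeight = 1 + X ^ 2 * (closedGF upsWeight + closedGF 1 +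
      (closedGF upsWeight * closedGFTail 1 + closedGF 1 * closedGFTail upsWeight)) := by
  have := closedGF_eq_of_coeff (f := upsWeight) (G := closedGF upsWeight + closedGF 1 +
      (closedGF upsWeight * closedGFTail 1 + closedGF 1 * closedGFTail upsWeight)) ?_
  · simpa [upsWeight] using this
  · intro n
    have key : ∀ a b, IsClosedPath b → upsWeight (join a b) = upsWeight a + upsWeight b := by
      intro a b hb
      simp only [upsWeight, count_join hb]
      push_cast
      ring
    rw [sum_closedPaths_add_two, map_add, map_add, map_add, coeff_mul, coeff_mul,
      ← Finset.sum_add_distrib]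
    congr 1
    · simp only [closedGF, coeff_mk, ← Finset.sum_add_distrib]
      refine Finset.sum_congr rfl fun a _ => ?_
      rw [key a [] isClosedPath_nil]
      simp [upsWeight]
    · refine Finset.sum_congr rfl fun ij _ => ?_
      simp only [closedGF, closedGFTail, coeff_mk, Finset.sum_mul_sum, ← Finset.sum_add_distrib]
      refine Finset.sum_congr rfl fun a _ => Finset.sum_congr rfl fun b hb => ?_
      rw [key a b (mem_closedPaths.1 hb).2]
      simp

/-- The square root of `(x²+x+1)(x²-3x+1)` with constant term `1`. -/
noncomputable def sqrtDisc : PowerSeries ℝ := 1 + X - X ^ 2 - 2 * X * closedGF 1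

theorem closedGF_one_quadratic :
    X * closedGF 1 ^ 2 + (X ^ 2 - X - 1) * closedGF 1 + 1 = 0 := by
  have h1 := closedGF_one_eq
  have h2 := closedGF_eq_tail 1
  simp only [Pi.one_apply, map_one] at h2
  linear_combination -h1 + X * closedGF 1 * h2

theorem sqrtDisc_sq : sqrtDisc ^ 2 = (X ^ 2 + X + 1) * (X ^ 2 - 3 * X + 1) := by
  rw [sqrtDisc]
  linear_combination 4 * X * closedGF_one_quadratic

theorem constantCoeff_sqrtDisc : constantCoeff sqrtDisc = 1 := by
  simp [sqrtDisc]

theorem two_mul_sqrtDisc_mul_closedGF :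
    2 * sqrtDisc * closedGF upsWeight = 1 + 2 * X ^ 2 - X ^ 3 + (1 - X) * sqrtDisc := by
  have h1 := closedGF_upsWeight_eq
  have h2 := closedGF_eq_tail 1
  have h3 := closedGF_eq_tail upsWeight
  simp only [Pi.one_apply, map_one] at h2
  have h0 : upsWeight [] = 1 := by simp [upsWeight]
  simp only [h0, map_one] at h3
  rw [sqrtDisc]
  linear_combination 2 * h1 - 2 * X * closedGF upsWeight * h2 - 2 * X * closedGF 1 * h3

/-! ### Removing a pyramid from a path -/

theorem countP_tails {α : Type*} (P : List α → Prop) [DecidablePred P] (p : List α) :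
    p.tails.countP (fun t => P t) =
      ((Finset.range (p.length + 1)).filter (fun i => P (p.drop i))).card := by
  induction p with
  | nil => simp [List.countP_cons]; split_ifs <;> rfl
  | cons a p ih =>
    rw [List.tails_cons, List.countP_cons, ih, Finset.card_filter, Finset.card_filter,
      List.length_cons, Finset.sum_range_succ' _ (p.length + 1)]
    simp

/-- The path does not start with a down-step. -/
def NotStartingDown (p : List Step) : Prop := ∀ s ∈ p.head?, ¬ s.IsDown

theorem height_pyramid (k : ℕ) : height (pyramid k) = 0 := by
  simp [pyramid, height]

theorem length_pyramid (k : ℕ) : (pyramid k).length = k + 1 := by simp [pyramid]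

theorem nonnegFrom_replicate_U (h : ℤ) (k : ℕ) :
    NonnegFrom h (List.replicate k Step.U) ↔ 0 ≤ h := by
  induction k generalizing h with
  | zero => simp
  | succ k ih =>
    rw [List.replicate_succ, nonnegFrom_cons, ih]
    simp
    omega

theorem nonnegFrom_pyramid (h : ℤ) (k : ℕ) : NonnegFrom h (pyramid k) ↔ 0 ≤ h := by
  rw [pyramid, nonnegFrom_append, nonnegFrom_replicate_U]
  simp [height]
  omega

/-- A pyramid has height 0 and never dips below its start. It begins with `U`, so nothing is
required of the step before it; it ends with a down-step, so the next step must not be one. -/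
theorem isClosedPath_insert_pyramid {k : ℕ} (hk : 1 ≤ k) (a b : List Step) :
    IsClosedPath (a ++ (pyramid k ++ b)) ↔ IsClosedPath (a ++ b) ∧ NotStartingDown b := by
  have hnn : NonnegFrom 0 (a ++ (pyramid k ++ b)) ↔ NonnegFrom 0 (a ++ b) := by
    simp only [nonnegFrom_append, nonnegFrom_pyramid, height_pyramid, add_zero]
    exact ⟨fun h => ⟨h.1, h.2.2⟩, fun h => ⟨h.1, h.2.start, h.2⟩⟩
  have hht : height (a ++ (pyramid k ++ b)) = height (a ++ b) := by simp [height_pyramid]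
  have hd : (∀ j, Step.D j ∈ a ++ (pyramid k ++ b) → 1 ≤ j) ↔
      ∀ j, Step.D j ∈ a ++ b → 1 ≤ j := by
    refine ⟨fun h j hj => h j ?_, fun h j hj => ?_⟩
    · simp only [List.mem_append] at hj ⊢
      tauto
    · simp only [pyramid, List.mem_append, List.mem_replicate, reduceCtorEq, and_false, false_or,
        List.mem_singleton, Step.D.injEq] at hj
      rcases hj with hj | rfl | hj
      · exact h j (by simp [hj])
      · exact hk
      · exact h j (by simp [hj])
  have hc : NoConsecutiveDowns (a ++ (pyramid k ++ b)) ↔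
      NoConsecutiveDowns (a ++ b) ∧ NotStartingDown b := by
    have hpyr : NoConsecutiveDowns (pyramid k) := by
      simp only [NoConsecutiveDowns, pyramid, List.isChain_append]
      refine ⟨List.isChain_replicate_of_rel k (by simp), by simp, ?_⟩
      intro x hx
      have := List.mem_of_mem_getLast? hx
      simp [(List.mem_replicate.1 this).2]
    have hlast : (pyramid k).getLast? = some (Step.D k) := by simp [pyramid]
    have hhead : (pyramid k ++ b).head? = some Step.U := by
      obtain ⟨k, rfl⟩ := Nat.exists_eq_add_of_le' hk
      simp [pyramid, List.replicate_succ]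
    simp only [NoConsecutiveDowns, List.isChain_append (l₁ := a), hhead,
      List.isChain_append (l₁ := pyramid k), hlast, NotStartingDown]
    simp only [Option.mem_some_iff, forall_eq', isDown_D, true_and, not_isDown_U, and_false,
      not_false_eq_true, implies_true, and_true]
    constructor
    · rintro ⟨ha, -, hb, h⟩
      exact ⟨⟨ha, hb, fun x _ y hy hxy => h y hy hxy.2⟩, h⟩
    · rintro ⟨⟨ha, hb, -⟩, h⟩
      exact ⟨ha, hpyr, hb, h⟩
  constructor
  · rintro ⟨h1, h2, h3, h4⟩
    exact ⟨⟨hd.1 h1, hnn.1 h2, hht ▸ h3, (hc.1 h4).1⟩, (hc.1 h4).2⟩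
  · rintro ⟨⟨h1, h2, h3, h4⟩, h5⟩
    exact ⟨hd.2 h1, hnn.2 h2, hht.trans h3, hc.2 ⟨h4, h5⟩⟩

/-- The admissible suffixes are the empty one and those beginning with a `U`. -/
theorem card_notStartingDown [DecidablePred NotStartingDown] (p : List Step) :
    ((Finset.range (p.length + 1)).filter (fun i => NotStartingDown (p.drop i))).card =
      1 + p.count Step.U := by
  rw [← countP_tails]
  induction p with
  | nil => simp [NotStartingDown]
  | cons s p ih =>
    rw [List.tails_cons, List.countP_cons, ih]
    cases s <;> simp [NotStartingDown, add_assoc]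

theorem popularity_eq_sum_closedPaths (w : List Step) (hw : w ≠ []) (n : ℕ) :
    popularity w n = ∑ p ∈ closedPaths n, occurrences w p := by
  unfold popularity closedPaths
  split_ifs with hn
  · subst hn
    have : (paths_finite 0).toFinset = ∅ := by
      refine Finset.eq_empty_of_forall_notMem fun p hp => ?_
      obtain ⟨h1, h2⟩ := (Set.Finite.mem_toFinset _).1 hp
      exact h2.nonempty (List.length_eq_zero_iff.1 h1)
    simp [this, occurrences, hw]
  · rfl

theorem pyramid_ne_nil (k : ℕ) : pyramid k ≠ [] := by simp [pyramid]

theorem exists_eq_append_of_prefix_drop {α : Type*} {p w : List α} {i : ℕ} (hi : i ≤ p.length)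
    (hw : w <+: p.drop i) : ∃ a b, p = a ++ (w ++ b) ∧ a.length = i := by
  obtain ⟨b, hb⟩ := hw
  exact ⟨p.take i, b, by rw [hb, List.take_append_drop], by simpa using hi⟩

theorem popularity_pyramid_add {k : ℕ} (hk : 1 ≤ k) (m : ℕ) :
    popularity (pyramid k) (m + (k + 1)) = ∑ p ∈ closedPaths m, (1 + p.count Step.U) := by
  classical
  have drop_insert : ∀ a b : List Step,
      (a ++ (pyramid k ++ b)).drop (a.length + (k + 1)) = b := by
    intro a b
    rw [← List.append_assoc, show a.length + (k + 1) = (a ++ pyramid k).length by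
      simp [length_pyramid], List.drop_left]
  rw [popularity_eq_sum_closedPaths _ (pyramid_ne_nil k)]
  simp only [occurrences, countP_tails, ← card_notStartingDown]
  rw [← Finset.card_sigma, ← Finset.card_sigma]
  -- Both maps keep the position and delete or insert the pyramid there.
  refine Finset.card_nbij'
    (fun x => ⟨x.1.take x.2 ++ x.1.drop (x.2 + (k + 1)), x.2⟩)
    (fun x => ⟨x.1.take x.2 ++ (pyramid k ++ x.1.drop x.2), x.2⟩) ?_ ?_ ?_ ?_
  · rintro ⟨p, i⟩ h
    simp only [Finset.coe_sigma, Set.mem_sigma_iff, Finset.mem_coe, Finset.mem_filter,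
      mem_closedPaths, Finset.mem_range] at h ⊢
    obtain ⟨⟨hl, hp⟩, hi, hw⟩ := h
    obtain ⟨a, b, rfl, rfl⟩ := exists_eq_append_of_prefix_drop (by omega) hw
    have hp' := (isClosedPath_insert_pyramid hk a b).1 hp
    simp only [List.length_append, length_pyramid] at hl
    simp only [drop_insert, List.take_left, List.drop_left]
    exact ⟨⟨by simp; omega, hp'.1⟩, by simp, hp'.2⟩
  · rintro ⟨p, i⟩ h
    simp only [Finset.coe_sigma, Set.mem_sigma_iff, Finset.mem_coe, Finset.mem_filter,
      mem_closedPaths, Finset.mem_range] at h ⊢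
    obtain ⟨⟨hl, hp⟩, hi, hw⟩ := h
    obtain ⟨a, b, rfl, rfl⟩ := exists_eq_append_of_prefix_drop (p := p) (i := i) (w := [])
      (by omega) (by simp)
    simp only [List.nil_append, List.length_append] at hp hw hl
    simp only [List.drop_left] at hw
    have hp' := (isClosedPath_insert_pyramid hk a b).2 ⟨hp, hw⟩
    simp [length_pyramid, hp']
    omega
  · rintro ⟨p, i⟩ h
    simp only [Finset.coe_sigma, Set.mem_sigma_iff, Finset.mem_coe, Finset.mem_filter,
      mem_closedPaths, Finset.mem_range] at h
    obtain ⟨⟨hl, hp⟩, hi, hw⟩ := h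
    obtain ⟨a, b, rfl, rfl⟩ := exists_eq_append_of_prefix_drop (by omega) hw
    simp [drop_insert]
  · rintro ⟨p, i⟩ h
    simp only [Finset.coe_sigma, Set.mem_sigma_iff, Finset.mem_coe, Finset.mem_filter,
      mem_closedPaths, Finset.mem_range] at h
    obtain ⟨⟨hl, hp⟩, hi, hw⟩ := h
    obtain ⟨a, b, rfl, rfl⟩ := exists_eq_append_of_prefix_drop (p := p) (i := i) (w := [])
      (by omega) (by simp)
    simp [drop_insert]

theorem popularity_pyramid_of_lt {k n : ℕ} (hn : n < k + 1) : popularity (pyramid k) n = 0 := by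
  rw [popularity_eq_sum_closedPaths _ (pyramid_ne_nil k)]
  refine Finset.sum_eq_zero fun p hp => ?_
  rw [occurrences, List.countP_eq_zero]
  intro t ht
  have h1 := (mem_closedPaths.1 hp).1
  have h2 := ((List.mem_tails _ _).1 ht).length_le
  simp only [decide_eq_true_eq]
  intro h
  have h3 := h.length_le
  rw [length_pyramid] at h3
  omega

theorem popularity_pyramid_add_real {k : ℕ} (hk : 1 ≤ k) (m : ℕ) :
    (popularity (pyramid k) (m + (k + 1)) : ℝ) = coeff m (closedGF upsWeight) := by
  rw [popularity_pyramid_add hk]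
  simp [closedGF, upsWeight]

theorem pyramidGF_eq_X_pow_mul {k : ℕ} (hk : 1 ≤ k) :
    pyramidGF k = X ^ (k + 1) * closedGF upsWeight := by
  ext n
  rw [coeff_X_pow_mul']
  split_ifs with h
  · obtain ⟨m, rfl⟩ := Nat.exists_eq_add_of_le' h
    simp [pyramidGF, popularity_pyramid_add_real hk]
  · simp [pyramidGF, popularity_pyramid_of_lt (not_le.1 h)]

theorem pyramidGF_eq {k : ℕ} (hk : 1 ≤ k) :
    pyramidGF k = X ^ (k + 1) * (1 + 2 * X ^ 2 - X ^ 3 + (1 - X) * sqrtDisc) *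
      (2 * sqrtDisc)⁻¹ := by
  have h : constantCoeff (2 * sqrtDisc) ≠ 0 := by
    rw [map_mul, constantCoeff_sqrtDisc, map_ofNat]
    norm_num
  rw [PowerSeries.eq_mul_inv_iff_mul_eq h, pyramidGF_eq_X_pow_mul hk,
    ← two_mul_sqrtDisc_mul_closedGF]
  ring

theorem popularity_pyramid_one_eq {k n : ℕ} (hk : 1 ≤ k) (hn : 2 ≤ n) :
    popularity (pyramid 1) n = popularity (pyramid k) (n + k - 1) := by
  obtain ⟨m, rfl⟩ := Nat.exists_eq_add_of_le' hn
  rw [show m + 2 + k - 1 = m + (k + 1) by omega, popularity_pyramid_add hk,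
    popularity_pyramid_add le_rfl]

/-! ### The series `(1 - x) ^ (-1/2)` -/

/-- The coefficients of `(1 - x) ^ (-1/2)`. -/
noncomputable def invSqrtCoeff (n : ℕ) : ℝ := n.centralBinom / 4 ^ n

theorem invSqrtCoeff_pos (n : ℕ) : 0 < invSqrtCoeff n := by
  have := n.centralBinom_pos
  unfold invSqrtCoeff
  positivity

theorem invSqrtCoeff_zero : invSqrtCoeff 0 = 1 := by simp [invSqrtCoeff]

theorem succ_mul_invSqrtCoeff_succ (n : ℕ) :
    ((n : ℝ) + 1) * invSqrtCoeff (n + 1) = (n + 1 / 2) * invSqrtCoeff n := by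
  have h : ((n : ℝ) + 1) * (n + 1).centralBinom = 2 * (2 * n + 1) * n.centralBinom := by
    exact_mod_cast n.succ_mul_centralBinom_succ
  unfold invSqrtCoeff
  rw [← mul_div_assoc, h, pow_succ]
  field_simp
  ring

theorem invSqrtCoeff_succ_le (n : ℕ) : invSqrtCoeff (n + 1) ≤ invSqrtCoeff n := by
  have h := succ_mul_invSqrtCoeff_succ n
  have := invSqrtCoeff_pos n
  have hn : (0 : ℝ) < n + 1 := by positivity
  refine le_of_mul_le_mul_left ?_ hn
  nlinarith

theorem invSqrtCoeff_le_one (n : ℕ) : invSqrtCoeff n ≤ 1 := by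
  induction n with
  | zero => simp [invSqrtCoeff_zero]
  | succ n ih => exact (invSqrtCoeff_succ_le n).trans ih

/-- Bounds the coefficient ratio by a factor depending only on the shift, as the dominated
convergence below requires. -/
theorem invSqrtCoeff_le_mul_add (m j : ℕ) :
    invSqrtCoeff m ≤ (j + 1) * invSqrtCoeff (m + j) := by
  induction j with
  | zero => simp
  | succ j ih =>
    have h := succ_mul_invSqrtCoeff_succ (m + j)
    have hp := invSqrtCoeff_pos (m + j)
    have hp' := invSqrtCoeff_pos (m + j + 1)
    rw [← add_assoc]
    push_cast at h ⊢
    refine ih.trans ?_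
    have hm : (0 : ℝ) ≤ m := m.cast_nonneg
    have hj : (0 : ℝ) ≤ j := j.cast_nonneg
    have hs : (0 : ℝ) < m + j + 1 / 2 := by positivity
    refine le_of_mul_le_mul_left ?_ hs
    calc ((m : ℝ) + j + 1 / 2) * ((j + 1) * invSqrtCoeff (m + j))
        = (j + 1) * ((m + j + 1) * invSqrtCoeff (m + j + 1)) := by rw [h]; ring
      _ ≤ _ := by nlinarith [mul_nonneg hm hp'.le, mul_nonneg hj hp'.le]

theorem wallis_mul_invSqrtCoeff_sq (n : ℕ) :
    Real.Wallis.W n * (2 * n + 1) * invSqrtCoeff n ^ 2 = 1 := by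
  have h : (n.centralBinom : ℝ) * (n.factorial * n.factorial) = (2 * n).factorial := by
    have := Nat.choose_mul_factorial_mul_factorial (show n ≤ 2 * n by omega)
    rw [show 2 * n - n = n by omega] at this
    rw [Nat.centralBinom]
    exact_mod_cast (mul_assoc _ _ _).symm.trans this
  have h1 : (n.factorial : ℝ) ≠ 0 := by positivity
  have h2 : (n.centralBinom : ℝ) ≠ 0 := by exact_mod_cast n.centralBinom_ne_zero
  rw [Real.Wallis.W_eq_factorial_ratio, ← h, invSqrtCoeff,
    show (2 : ℝ) ^ (4 * n) = (4 ^ n) ^ 2 by rw [← pow_mul, mul_comm n 2, pow_mul, pow_mul]; norm_num]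
  field_simp

/-- The shift `c` absorbs the offset k + 1 between path length and coefficient index. -/
theorem tendsto_invSqrtCoeff_mul_sqrt (c : ℕ) :
    Tendsto (fun n : ℕ => invSqrtCoeff n * √(Real.pi * ((n + c : ℕ) : ℝ))) atTop (nhds 1) := by
  have hlin : Tendsto (fun n : ℕ => ((n + c : ℕ) : ℝ) / (2 * n + 1)) atTop (nhds (1 / 2)) := by
    have h1 : Tendsto (fun n : ℕ => (c - 1 / 2 : ℝ) / 2 / ((n : ℝ) + 1 / 2)) atTop (nhds 0) :=
      tendsto_const_nhds.div_atTop
        (tendsto_atTop_add_const_right _ _ tendsto_natCast_atTop_atTop)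
    have h2 := h1.const_add (1 / 2 : ℝ)
    rw [add_zero] at h2
    refine h2.congr fun n => ?_
    have : (0 : ℝ) ≤ n := n.cast_nonneg
    push_cast
    field_simp
    ring
  have hW := Real.Wallis.tendsto_W_nhds_pi_div_two
  have hpi : Real.pi / 2 ≠ 0 := by positivity
  have hlim := ((hlin.const_mul Real.pi).div hW hpi).sqrt
  have e : √(Real.pi * (1 / 2) / (Real.pi / 2)) = 1 := by
    rw [show Real.pi * (1 / 2) / (Real.pi / 2) = 1 by field_simp, Real.sqrt_one]
  rw [e] at hlim
  refine hlim.congr fun n => ?_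
  have hb := invSqrtCoeff_pos n
  have hw := Real.Wallis.W_pos n
  have h := wallis_mul_invSqrtCoeff_sq n
  rw [← Real.sqrt_sq hb.le, ← Real.sqrt_mul (sq_nonneg _)]
  congr 1
  simp only [Pi.div_apply]
  have hn : (0 : ℝ) < 2 * n + 1 := by positivity
  field_simp
  linear_combination (-((n + c : ℕ) : ℝ)) * h

theorem tendsto_invSqrtCoeff_div_add (j : ℕ) :
    Tendsto (fun n => invSqrtCoeff n / invSqrtCoeff (n + j)) atTop (nhds 1) := by
  have h1 := tendsto_invSqrtCoeff_mul_sqrt j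
  have h2 := (tendsto_add_atTop_iff_nat j).2 (tendsto_invSqrtCoeff_mul_sqrt 0)
  have h := h1.div h2 one_ne_zero
  rw [div_one] at h
  refine h.congr' ?_
  filter_upwards [eventually_gt_atTop 0] with n hn
  have : (0 : ℝ) < ((n + j : ℕ) : ℝ) := by exact_mod_cast Nat.add_pos_left hn j
  have hs : 0 < √(Real.pi * ((n + j : ℕ) : ℝ)) := Real.sqrt_pos.2 (by positivity)
  have := invSqrtCoeff_pos (n + j)
  simp only [Pi.div_apply, add_zero]
  field_simp

/-- The formal power series `(1 - x) ^ (-1/2)`. -/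
noncomputable def invSqrtSeries : PowerSeries ℝ := PowerSeries.mk invSqrtCoeff

theorem constantCoeff_invSqrtSeries : constantCoeff invSqrtSeries = 1 := by
  rw [← coeff_zero_eq_constantCoeff_apply, invSqrtSeries, coeff_mk, invSqrtCoeff_zero]

theorem one_sub_X_mul_derivative_invSqrtSeries :
    2 * ((1 - X) * d⁄dX ℝ invSqrtSeries) = invSqrtSeries := by
  ext n
  have h := succ_mul_invSqrtCoeff_succ n
  have h2 : (2 : PowerSeries ℝ) = C (2 : ℝ) := (map_ofNat C 2).symm
  rw [h2, coeff_C_mul, sub_mul, one_mul, map_sub]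
  cases n with
  | zero =>
    simp [coeff_derivative, invSqrtSeries] at h ⊢
    linarith
  | succ n =>
    simp only [coeff_succ_X_mul, coeff_derivative, invSqrtSeries, coeff_mk]
    push_cast at h ⊢
    linear_combination 2 * h

/-- By the differential equation the left side has derivative zero, and its constant term is 1. -/
theorem one_sub_X_mul_invSqrtSeries_sq : (1 - X) * invSqrtSeries ^ 2 = 1 := by
  refine derivative.ext ?_ ?_
  · have h := one_sub_X_mul_derivative_invSqrtSeries
    simp only [Derivation.leibniz, Derivation.leibniz_pow, map_sub, derivative_X,
      Derivation.map_one_eq_zero, smul_eq_mul]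
    simp only [nsmul_eq_mul, Nat.cast_ofNat, Nat.add_one_sub_one, pow_one]
    linear_combination invSqrtSeries * h
  · simp [constantCoeff_invSqrtSeries]

/-! ### Evaluation of power series -/

/-- The series `f` converges at `r` with sum `v`. -/
def HasEval (f : PowerSeries ℝ) (r v : ℝ) : Prop := HasSum (fun n => coeff n f * r ^ n) v

theorem HasEval.unique {f : PowerSeries ℝ} {r v w : ℝ} (hv : HasEval f r v) (hw : HasEval f r w) :
    v = w := HasSum.unique hv hw

theorem HasEval.add {f g : PowerSeries ℝ} {r v w : ℝ} (hf : HasEval f r v) (hg : HasEval g r w) :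
    HasEval (f + g) r (v + w) := by
  simpa [HasEval, add_mul] using HasSum.add hf hg

theorem HasEval.sub {f g : PowerSeries ℝ} {r v w : ℝ} (hf : HasEval f r v) (hg : HasEval g r w) :
    HasEval (f - g) r (v - w) := by
  simpa [HasEval, sub_mul] using HasSum.sub hf hg

theorem HasEval.mul {f g : PowerSeries ℝ} {r v w : ℝ} (hf : HasEval f r v) (hg : HasEval g r w) :
    HasEval (f * g) r (v * w) := by
  have hf' := hf.summable.norm
  have hg' := hg.summable.norm
  have h1 := (summable_norm_sum_mul_antidiagonal_of_summable_norm hf' hg').of_norm.hasSum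
  rw [← tsum_mul_tsum_eq_tsum_sum_antidiagonal_of_summable_norm hf' hg', hf.tsum_eq,
    hg.tsum_eq] at h1
  have e : (fun n => coeff n (f * g) * r ^ n) = fun n =>
      ∑ kl ∈ Finset.HasAntidiagonal.antidiagonal n,
        (coeff kl.1 f * r ^ kl.1) * (coeff kl.2 g * r ^ kl.2) := by
    funext n
    rw [coeff_mul, Finset.sum_mul]
    refine Finset.sum_congr rfl fun ij hij => ?_
    rw [← Finset.HasAntidiagonal.mem_antidiagonal.1 hij, pow_add]
    ring
  unfold HasEval
  rw [e]
  exact h1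

theorem hasEval_C (a r : ℝ) : HasEval (C a) r a := by
  have := hasSum_single (f := fun n => coeff n (C a) * r ^ n) 0 fun n hn => by
    simp [coeff_C, hn]
  simpa [HasEval] using this

theorem hasEval_one (r : ℝ) : HasEval 1 r 1 := by
  simpa using hasEval_C 1 r

theorem hasEval_X (r : ℝ) : HasEval X r r := by
  have := hasSum_single (f := fun n => coeff n (X : PowerSeries ℝ) * r ^ n) 1 fun n hn => by
    simp [coeff_X, hn]
  simpa [HasEval] using this

theorem HasEval.pow {f : PowerSeries ℝ} {r v : ℝ} (hf : HasEval f r v) (n : ℕ) :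
    HasEval (f ^ n) r (v ^ n) := by
  induction n with
  | zero => simpa using hasEval_one r
  | succ n ih => simpa [pow_succ] using ih.mul hf

theorem HasEval.rescale {f : PowerSeries ℝ} {a r v : ℝ} (hf : HasEval f (a * r) v) :
    HasEval (PowerSeries.rescale a f) r v := by
  unfold HasEval at hf ⊢
  convert hf using 2 with n
  rw [coeff_rescale, mul_pow]
  ring

theorem HasEval.expand {f : PowerSeries ℝ} {p : ℕ} (hp : p ≠ 0) {r v : ℝ}
    (hf : HasEval f (r ^ p) v) : HasEval (PowerSeries.expand p hp f) r v := by
  have hinj : Function.Injective (fun n => p * n) := fun a b h =>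
    Nat.eq_of_mul_eq_mul_left (Nat.pos_of_ne_zero hp) h
  refine (hinj.hasSum_iff ?_).1 ?_
  · intro n hn
    rw [coeff_expand_of_not_dvd p hp f (fun ⟨m, hm⟩ => hn ⟨m, hm.symm⟩), zero_mul]
  · simpa [HasEval, Function.comp_def, pow_mul] using hf

/-- Comparison with the geometric series gives convergence. The sum v satisfies (1 - r) v² = 1, and
v ≥ 0 selects the root. -/
theorem hasEval_invSqrtSeries {r : ℝ} (h0 : 0 ≤ r) (h1 : r < 1) :
    HasEval invSqrtSeries r (√(1 - r))⁻¹ := by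
  have hsum : Summable (fun n => coeff n invSqrtSeries * r ^ n) := by
    refine (summable_geometric_of_lt_one h0 h1).of_nonneg_of_le (fun n => ?_) fun n => ?_
    · rw [invSqrtSeries, coeff_mk]
      have := invSqrtCoeff_pos n
      positivity
    · rw [invSqrtSeries, coeff_mk]
      exact mul_le_of_le_one_left (pow_nonneg h0 n) (invSqrtCoeff_le_one n)
  obtain ⟨v, hv⟩ := hsum
  have hv0 : 0 ≤ v := hv.nonneg fun n => by
    rw [invSqrtSeries, coeff_mk]
    have := invSqrtCoeff_pos n
    positivity
  have hv : HasEval invSqrtSeries r v := hv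
  have key := ((hasEval_one r).sub (hasEval_X r)).mul (hv.pow 2)
  rw [one_sub_X_mul_invSqrtSeries_sq] at key
  have e := key.unique (hasEval_one r)
  have : v = (√(1 - r))⁻¹ := by
    rw [← Real.sqrt_inv, eq_comm, Real.sqrt_eq_iff_mul_self_eq (by simp; linarith) hv0]
    have : (1 - r) ≠ 0 := by linarith
    field_simp
    linarith
  rwa [← this]

/-! ### Transfer of the singular behaviour to the coefficients -/

/-- With b = `invSqrtCoeff`, the normalised coefficient is the sum over j ≤ n of (b(n-j)/b(n)) times
the j-th term of T at ρ. Each ratio tends to 1 and is at most j + 1, a factor absorbed by the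
geometric gain from ρ to r. -/
theorem tendsto_coeff_rescale_invSqrtSeries_mul {T : PowerSeries ℝ} {ρ r v w : ℝ} (hρ : 0 < ρ)
    (hr : ρ < r) (hT : HasEval T r w) (hv : HasEval T ρ v) :
    Tendsto (fun n => coeff n (rescale ρ⁻¹ invSqrtSeries * T) * ρ ^ n / invSqrtCoeff n)
      atTop (nhds v) := by
  set δ := r / ρ - 1 with hδ
  have hδ0 : 0 < δ := by rw [hδ, sub_pos, one_lt_div hρ]; exact hr
  obtain ⟨K, hK⟩ : ∃ K : ℝ, ∀ j : ℕ, (j + 1) * ρ ^ j ≤ K * r ^ j := by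
    -- Bernoulli's inequality for (r/ρ)^j = (1 + δ)^j yields this constant.
    refine ⟨1 + δ⁻¹, fun j => ?_⟩
    have h1 : 1 + (j : ℝ) * δ ≤ (1 + δ) ^ j := one_add_mul_le_pow (by linarith) j
    have h2 : r ^ j = (1 + δ) ^ j * ρ ^ j := by
      rw [← mul_pow, hδ]
      congr 1
      field_simp
      ring
    rw [h2, ← mul_assoc]
    refine mul_le_mul_of_nonneg_right ?_ (by positivity)
    calc (j : ℝ) + 1 ≤ (1 + δ⁻¹) * (1 + j * δ) := by
          have : (1 + δ⁻¹) * (1 + j * δ) = 1 + j * δ + δ⁻¹ + j := by field_simp; ring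
          rw [this]
          have : 0 ≤ j * δ + δ⁻¹ := by positivity
          linarith
      _ ≤ _ := mul_le_mul_of_nonneg_left h1 (by positivity)
  let f : ℕ → ℕ → ℝ := fun n j =>
    if j ≤ n then invSqrtCoeff (n - j) / invSqrtCoeff n * (coeff j T * ρ ^ j) else 0
  have hbound : Summable fun j => K * ‖coeff j T * r ^ j‖ := hT.summable.norm.mul_left K
  have hlim : ∀ j, Tendsto (f · j) atTop (nhds (coeff j T * ρ ^ j)) := by
    intro j
    rw [← tendsto_add_atTop_iff_nat j]
    have := (tendsto_invSqrtCoeff_div_add j).mul_const (coeff j T * ρ ^ j)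
    rw [one_mul] at this
    simpa [f] using this
  have hle : ∀ n j, ‖f n j‖ ≤ K * ‖coeff j T * r ^ j‖ := by
    intro n j
    have hnn : 0 ≤ K * ‖coeff j T * r ^ j‖ := by
      have := (hK j).trans' (by positivity : (0 : ℝ) ≤ (j + 1) * ρ ^ j)
      have hr0 : 0 ≤ r ^ j := pow_nonneg (hρ.trans hr).le j
      rw [norm_mul, mul_left_comm, Real.norm_of_nonneg hr0]
      exact mul_nonneg (norm_nonneg _) this
    simp only [f]
    split_ifs with h
    · obtain ⟨m, rfl⟩ := Nat.exists_eq_add_of_le' h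
      have hb := invSqrtCoeff_le_mul_add m j
      have hp := invSqrtCoeff_pos (m + j)
      have hp' := invSqrtCoeff_pos m
      rw [Nat.add_sub_cancel, norm_mul, norm_mul, norm_mul,
        Real.norm_of_nonneg (by positivity : 0 ≤ invSqrtCoeff m / invSqrtCoeff (m + j)),
        Real.norm_of_nonneg (by positivity : 0 ≤ ρ ^ j),
        Real.norm_of_nonneg (by have := hρ.trans hr; positivity : 0 ≤ r ^ j)]
      have hq : invSqrtCoeff m / invSqrtCoeff (m + j) ≤ j + 1 := by rwa [div_le_iff₀ hp]
      calc invSqrtCoeff m / invSqrtCoeff (m + j) * (‖coeff j T‖ * ρ ^ j)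
          ≤ (j + 1) * (‖coeff j T‖ * ρ ^ j) := mul_le_mul_of_nonneg_right hq (by positivity)
        _ = ‖coeff j T‖ * ((j + 1) * ρ ^ j) := by ring
        _ ≤ ‖coeff j T‖ * (K * r ^ j) := mul_le_mul_of_nonneg_left (hK j) (norm_nonneg _)
        _ = _ := by ring
    · simpa using hnn
  have h := tendsto_tsum_of_dominated_convergence hbound hlim (Eventually.of_forall hle)
  rw [hv.tsum_eq] at h
  refine h.congr fun n => ?_
  rw [tsum_eq_sum (s := Finset.range (n + 1)) (fun j hj => by
    simp only [Finset.mem_range, not_lt] at hj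
    simp only [f]
    rw [if_neg (by omega)])]
  rw [mul_comm (rescale _ _), coeff_mul, Finset.Nat.sum_antidiagonal_eq_sum_range_succ_mk,
    Finset.sum_mul, Finset.sum_div]
  refine Finset.sum_congr rfl fun j hj => ?_
  have hjn : j ≤ n := by simpa [Nat.lt_succ_iff] using hj
  obtain ⟨m, rfl⟩ := Nat.exists_eq_add_of_le' hjn
  simp only [f, if_pos hjn, Nat.add_sub_cancel, coeff_rescale, invSqrtSeries, coeff_mk, inv_pow,
    pow_add]
  field_simp

/-! ### Asymptotics of the popularity of pyramids -/

/-- The dominant singularity, the smallest root of `x² - 3x + 1`. -/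
noncomputable def singularity : ℝ := (3 - √5) / 2

theorem two_lt_sqrt_five : (2 : ℝ) < √5 := by
  rw [Real.lt_sqrt] <;> norm_num

theorem sqrt_five_lt : √5 < (9 / 4 : ℝ) := by
  rw [Real.sqrt_lt'] <;> norm_num

theorem singularity_pos : 0 < singularity := by
  have := sqrt_five_lt
  unfold singularity
  linarith

theorem singularity_lt_half : singularity < 1 / 2 := by
  have := two_lt_sqrt_five
  unfold singularity
  linarith

theorem inv_singularity : singularity⁻¹ = (3 + √5) / 2 := by
  have h := Real.sq_sqrt (show (0 : ℝ) ≤ 5 by norm_num)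
  refine inv_eq_of_mul_eq_one_left ?_
  unfold singularity
  linear_combination -h / 4

/-- The reciprocal of `√((x² + x + 1) (1 - ρ x))`, where `ρ` is the dominant singularity. -/
noncomputable def regularFactor : PowerSeries ℝ :=
  rescale singularity invSqrtSeries * ((1 - X) * invSqrtSeries * expand 3 three_ne_zero invSqrtSeries)

theorem sqrtDisc_mul_eq_one :
    sqrtDisc * (rescale singularity⁻¹ invSqrtSeries * regularFactor) = 1 := by
  have hB := one_sub_X_mul_invSqrtSeries_sq
  have h1 := congrArg (rescale singularity⁻¹) hB
  have h2 := congrArg (rescale singularity) hB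
  have h3 := congrArg (expand 3 three_ne_zero) hB
  simp only [map_mul, map_sub, map_one, map_pow, rescale_X, expand_X] at h1 h2 h3
  have hsum : singularity⁻¹ + singularity = 3 := by
    rw [inv_singularity, singularity]; ring
  have hprod : singularity⁻¹ * singularity = 1 := inv_mul_cancel₀ singularity_pos.ne'
  have hsum' := congrArg (C : ℝ →+* PowerSeries ℝ) hsum
  have hprod' := congrArg (C : ℝ →+* PowerSeries ℝ) hprod
  simp only [map_add, map_mul, map_one, map_ofNat] at hsum' hprod'
  have hq : (X ^ 2 - 3 * X + 1 : PowerSeries ℝ) =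
      (1 - C singularity⁻¹ * X) * (1 - C singularity * X) := by
    linear_combination X * hsum' - X ^ 2 * hprod'
  have hsq : (sqrtDisc * (rescale singularity⁻¹ invSqrtSeries * regularFactor)) ^ 2 = 1 := by
    rw [mul_pow, sqrtDisc_sq, hq, regularFactor]
    generalize rescale singularity⁻¹ invSqrtSeries = R at *
    generalize rescale singularity invSqrtSeries = Q at *
    generalize expand 3 three_ne_zero invSqrtSeries = E at *
    -- Uses (x² + x + 1)(1 - x) = 1 - x³, which lets every factor be inverted by a substitution in
    -- `invSqrtSeries`.
    calc _ = ((1 - C singularity⁻¹ * X) * R ^ 2) * ((1 - C singularity * X) * Q ^ 2) *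
          ((1 - X) * invSqrtSeries ^ 2) * ((1 - X ^ 3) * E ^ 2) := by ring
      _ = 1 := by rw [h1, h2, hB, h3]; ring
  -- Power series over ℝ form a domain, so the product is ±1; constant terms rule out -1.
  rcases mul_self_eq_one_iff.1 ((sq _).symm.trans hsq) with h | h
  · exact h
  · have hres : ∀ a : ℝ, constantCoeff (rescale a invSqrtSeries) = 1 := fun a => by
      rw [← coeff_zero_eq_constantCoeff_apply, coeff_rescale, coeff_zero_eq_constantCoeff_apply,
        constantCoeff_invSqrtSeries, pow_zero, one_mul]
    have := congrArg constantCoeff h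
    simp only [regularFactor, map_mul, map_sub, map_neg, map_one, hres, constantCoeff_X,
      constantCoeff_expand, constantCoeff_invSqrtSeries, constantCoeff_sqrtDisc] at this
    norm_num at this

theorem closedGF_upsWeight_eq_singular :
    closedGF upsWeight = rescale singularity⁻¹ invSqrtSeries *
      (C (1 / 2) * (1 + C 2 * X ^ 2 - X ^ 3) * regularFactor) + C (1 / 2) * (1 - X) := by
  have h := two_mul_sqrtDisc_mul_closedGF
  have h1 := sqrtDisc_mul_eq_one
  have h2 : C (1 / 2 : ℝ) * 2 = 1 := by
    rw [← map_ofNat C 2, ← map_mul]; norm_num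
  have h3 : C (2 : ℝ) = 2 := map_ofNat C 2
  rw [h3]
  generalize rescale singularity⁻¹ invSqrtSeries = R at *
  linear_combination C (1 / 2) * R * regularFactor * h +
    (C (1 / 2) * (1 - X) - C (1 / 2) * 2 * closedGF upsWeight) * h1 - closedGF upsWeight * h2

theorem hasEval_regularFactor {r : ℝ} (h0 : 0 ≤ r) (h1 : r < 1) :
    HasEval regularFactor r ((√(1 - singularity * r))⁻¹ *
      ((1 - r) * (√(1 - r))⁻¹ * (√(1 - r ^ 3))⁻¹)) := by
  have hs := singularity_pos
  have hs' := singularity_lt_half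
  refine HasEval.mul (HasEval.rescale (hasEval_invSqrtSeries (by positivity) (by nlinarith)))
    ((((hasEval_one r).sub (hasEval_X r)).mul (hasEval_invSqrtSeries h0 h1)).mul
      (HasEval.expand _ (hasEval_invSqrtSeries (by positivity) (pow_lt_one₀ h0 h1 three_ne_zero))))

theorem hasEval_amplitude {r : ℝ} (h0 : 0 ≤ r) (h1 : r < 1) :
    HasEval (C (1 / 2) * (1 + C 2 * X ^ 2 - X ^ 3) * regularFactor) r
      (1 / 2 * (1 + 2 * r ^ 2 - r ^ 3) * ((√(1 - singularity * r))⁻¹ *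
        ((1 - r) * (√(1 - r))⁻¹ * (√(1 - r ^ 3))⁻¹))) :=
  ((hasEval_C _ r).mul (((hasEval_one r).add ((hasEval_C 2 r).mul ((hasEval_X r).pow 2))).sub
    ((hasEval_X r).pow 3))).mul (hasEval_regularFactor h0 h1)

theorem amplitude_eq :
    1 / 2 * (1 + 2 * singularity ^ 2 - singularity ^ 3) *
      ((√(1 - singularity * singularity))⁻¹ *
        ((1 - singularity) * (√(1 - singularity))⁻¹ * (√(1 - singularity ^ 3))⁻¹)) =
      (√5 - 1) / (2 * √(14 * √5 - 30)) := by
  have hs := singularity_pos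
  have hs' := singularity_lt_half
  have h5 := Real.sq_sqrt (show (0 : ℝ) ≤ 5 by norm_num)
  have ha : 0 < 1 - singularity * singularity := by nlinarith
  have hb : 0 < 1 - singularity := by linarith
  have hc : 0 < 1 - singularity ^ 3 := by
    have := pow_lt_one₀ hs.le (by linarith : singularity < 1) three_ne_zero
    linarith
  have hd : 0 < 14 * √5 - 30 := by
    have : (15 / 7 : ℝ) < √5 := by rw [Real.lt_sqrt] <;> norm_num
    linarith
  have hnum : 1 + 2 * singularity ^ 2 - singularity ^ 3 = √5 - 1 := by
    unfold singularity
    linear_combination (√5 - 5) / 8 * h5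
  have hroot : √(14 * √5 - 30) * (1 - singularity) =
      √(1 - singularity * singularity) * √(1 - singularity) * √(1 - singularity ^ 3) := by
    have hsv : √5 = 3 - 2 * singularity := by unfold singularity; ring
    have hroot : singularity ^ 2 - 3 * singularity + 1 = 0 := by
      unfold singularity
      linear_combination h5 / 4
    have e : √(14 * √5 - 30) * (1 - singularity) =
        √((14 * √5 - 30) * (1 - singularity) ^ 2) := by
      rw [Real.sqrt_mul hd.le, Real.sqrt_sq hb.le]
    rw [e, ← Real.sqrt_mul ha.le, ← Real.sqrt_mul (by positivity)]
    congr 1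
    -- After √5 = 3 - 2ρ, the quadratic cofactor is the quotient of 11 - 29ρ + ρ³ + ρ⁴ by ρ² - 3ρ +
    -- 1.
    linear_combination 14 * (1 - singularity) ^ 2 * hsv +
      (1 - singularity) ^ 2 * (singularity ^ 2 + 4 * singularity + 11) * hroot
  have := Real.sqrt_pos.2 ha
  have := Real.sqrt_pos.2 hb
  have := Real.sqrt_pos.2 hc
  have := Real.sqrt_pos.2 hd
  rw [hnum]
  generalize √(1 - singularity * singularity) = a at *
  generalize √(1 - singularity) = b at *
  generalize √(1 - singularity ^ 3) = c at *
  generalize √(14 * √5 - 30) = d at *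
  field_simp
  linear_combination (√5 - 1) * hroot

theorem tendsto_coeff_closedGF_upsWeight :
    Tendsto (fun m => coeff m (closedGF upsWeight) * singularity ^ m / invSqrtCoeff m) atTop
      (nhds ((√5 - 1) / (2 * √(14 * √5 - 30)))) := by
  have hs := singularity_pos
  have hs' := singularity_lt_half
  have h := tendsto_coeff_rescale_invSqrtSeries_mul hs hs'
    (hasEval_amplitude (by norm_num) (by norm_num)) (hasEval_amplitude hs.le (by linarith))
  rw [amplitude_eq] at h
  refine h.congr' ?_
  -- The polynomial part (1 - x)/2 only affects coefficients 0 and 1.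
  filter_upwards [eventually_ge_atTop 2] with m hm
  congr 2
  rw [closedGF_upsWeight_eq_singular, map_add]
  obtain ⟨m, rfl⟩ := Nat.exists_eq_add_of_le' hm
  have : coeff (m + 2) (C (1 / 2 : ℝ) * (1 - X)) = 0 := by
    rw [coeff_C_mul, map_sub, coeff_one, coeff_X]
    simp
  rw [this, add_zero]

theorem popularity_pyramid_isEquivalent {k : ℕ} (hk : 1 ≤ k) :
    (fun n : ℕ => (popularity (pyramid k) n : ℝ)) ~[atTop]
      (fun n : ℕ => (√5 - 1) / (2 * √(Real.pi * n) * √(14 * √5 - 30)) *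
        ((3 + √5) / 2) ^ ((n : ℤ) - (k : ℤ) - 1)) := by
  refine isEquivalent_of_tendsto_one ?_
  -- With n = m + k + 1 the integer exponent becomes the natural number m.
  rw [← tendsto_add_atTop_iff_nat (k + 1)]
  have hd : 0 < 14 * √5 - 30 := by
    have : (15 / 7 : ℝ) < √5 := by rw [Real.lt_sqrt] <;> norm_num
    linarith
  have hd' := Real.sqrt_pos.2 hd
  have h5 : 0 < √5 - 1 := by linarith [two_lt_sqrt_five]
  set K := (√5 - 1) / (2 * √(14 * √5 - 30)) with hK
  have hK0 : K ≠ 0 := by positivity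
  have h := (tendsto_coeff_closedGF_upsWeight.mul
    (tendsto_invSqrtCoeff_mul_sqrt (k + 1))).div_const K
  rw [mul_one, div_self hK0] at h
  refine h.congr fun m => ?_
  have hb := invSqrtCoeff_pos m
  have hs := singularity_pos
  have hm : 0 < √(Real.pi * ((m + (k + 1) : ℕ) : ℝ)) := by
    refine Real.sqrt_pos.2 (mul_pos Real.pi_pos ?_)
    exact_mod_cast Nat.succ_pos (m + k)
  rw [Pi.div_apply, popularity_pyramid_add_real hk, ← inv_singularity,
    show ((m + (k + 1) : ℕ) : ℤ) - k - 1 = (m : ℕ) by push_cast; ring, zpow_natCast, inv_pow, hK]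
  field_simp

end AirPockets

/-- `S` is the formal square root of `(x²+x+1)(x²-3x+1)` with constant term `1`. -/
theorem corollary8 :
    (∃ S : PowerSeries ℝ,
      S ^ 2 = (X ^ 2 + X + 1) * (X ^ 2 - 3 * X + 1) ∧ constantCoeff S = 1 ∧
      ∀ k : ℕ, 1 ≤ k →
        pyramidGF k =
          X ^ (k + 1) * (1 + 2 * X ^ 2 - X ^ 3 + (1 - X) * S) * (2 * S)⁻¹) ∧
    (∀ k n : ℕ, 1 ≤ k → 2 ≤ n →
      popularity (pyramid 1) n = popularity (pyramid k) (n + k - 1)) ∧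
    (∀ k : ℕ, 1 ≤ k →
      (fun n : ℕ => (popularity (pyramid k) n : ℝ)) ~[atTop]
        (fun n : ℕ =>
          (√5 - 1) / (2 * √(Real.pi * n) * √(14 * √5 - 30)) *
            ((3 + √5) / 2) ^ ((n : ℤ) - (k : ℤ) - 1))) := by
  exact ⟨⟨sqrtDisc, sqrtDisc_sq, constantCoeff_sqrtDisc, fun _ hk => pyramidGF_eq hk⟩,
    fun _ _ hk hn => popularity_pyramid_one_eq hk hn,
    fun _ hk => popularity_pyramid_isEquivalent hk⟩
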